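/- **Proposition A.1.** Let $G$ and $H$ be finitely generated infinite (discrete) groups, and suppose that $H$ is amenable, i.e. that $H$ admits a left-invariant mean on $\ell^\infty(H)$. Let $H\wr G=\bigl(\bigoplus_{G}H\bigr)\rtimes G$ be the restricted wreath product, where $G$ acts on the finitely supported functions $G\to H$ by translation. Then $H\wr G$ does not have Shalom's property $H_{\mathrm{FD}}$. Here a group $\Gamma$ has property $H_{\mathrm{FD}}$ if every unitary representation $\pi$ of $\Gamma$ on a complex Hilbert space $\mathcal H$ with $\overline{H}^1(\Gamma,\pi)\neq 0$ admits a nonzero finite-dimensional subrepresentation, where $\overline{H}^1(\Gamma,\pi)=Z^1(\Gamma,\pi)/\overline{B^1(\Gamma,\pi)}$, $Z^1(\Gamma,\pi)$ is the space of maps $b:\Gamma\to\mathcal H$ with $b(gh)=b(g)+\pi_g b(h)$ for all $g,h\in\Gamma$, $B^1(\Gamma,\pi)$ is the subspace of maps of the form $b(g)=v-\pi_g v$ with $v\in\mathcal H$, and the closure is for uniform convergence on finite subsets of $\Gamma$. -/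

import Mathlib

open scoped ENNReal

universe u v

section UnitaryRepresentations

variable {Γ : Type u} [Group Γ] {E : Type v} [NormedAddCommGroup E] [InnerProductSpace ℂ E]

/-- The space `Z¹(Γ, π)` of `1`-cocycles of a unitary representation `π`, that is, of the maps
`b : Γ → E` with `b (g h) = b g + π g (b h)`. The unitary group of `E` is the group
`E ≃ₗᵢ[ℂ] E` of surjective linear isometries. -/
def oneCocycles (π : Γ →* (E ≃ₗᵢ[ℂ] E)) : Submodule ℂ (Γ → E) where
  carrier := {b | ∀ g h : Γ, b (g * h) = b g + π g (b h)}
  zero_mem' := by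
    intro g h
    simp
  add_mem' := by
    intro b c hb hc g h
    simp only [Pi.add_apply, hb g h, hc g h, map_add]
    abel
  smul_mem' := by
    intro a b hb g h
    simp only [Pi.smul_apply, hb g h, map_smul, smul_add]

/-- The space `B¹(Γ, π)` of `1`-coboundaries, that is, of the cocycles of the form
`g ↦ v - π g v` for a vector `v`, as a subspace of `Z¹(Γ, π)`. -/
def oneCoboundaries (π : Γ →* (E ≃ₗᵢ[ℂ] E)) : Submodule ℂ (oneCocycles π) where
  carrier := {b | ∃ v : E, ∀ g : Γ, (b : Γ → E) g = v - π g v}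
  zero_mem' := ⟨0, by intro g; simp⟩
  add_mem' := by
    rintro b c ⟨v, hv⟩ ⟨w, hw⟩
    refine ⟨v + w, fun g => ?_⟩
    simp only [Submodule.coe_add, Pi.add_apply, hv g, hw g, map_add]
    abel
  smul_mem' := by
    rintro a b ⟨v, hv⟩
    refine ⟨a • v, fun g => ?_⟩
    simp only [Submodule.coe_smul, Pi.smul_apply, hv g, map_smul, smul_sub]

/-- The first reduced cohomology `Z¹(Γ, π) / closure B¹(Γ, π)`. The topology on `Z¹(Γ, π)` is the
one induced from the product topology on `Γ → E`: since `Γ` is discrete, this is the topology of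
uniform convergence on compact (that is, finite) subsets of `Γ`. -/
abbrev ReducedH1 (π : Γ →* (E ≃ₗᵢ[ℂ] E)) : Type (max u v) :=
  oneCocycles π ⧸ (oneCoboundaries π).topologicalClosure

/-- The unitary representation `π` admits a (nonzero) finite dimensional subrepresentation. -/
def HasFiniteDimSubrep (π : Γ →* (E ≃ₗᵢ[ℂ] E)) : Prop :=
  ∃ V : Submodule ℂ E, V ≠ ⊥ ∧ FiniteDimensional ℂ V ∧ ∀ g : Γ, ∀ x ∈ V, π g x ∈ V

end UnitaryRepresentations

/-- Shalom's property `H_FD` of a (discrete) group: every unitary representation on a complex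
Hilbert space whose first reduced cohomology is nonzero has a nonzero finite dimensional
subrepresentation. The Hilbert spaces range over the universe of the group; for a countable group
this is no restriction, as one can pass to the closed span of the values of a cocycle. -/
def PropertyHFD (Γ : Type u) [Group Γ] : Prop :=
  ∀ (E : Type u) [NormedAddCommGroup E] [InnerProductSpace ℂ E] [CompleteSpace E]
    (π : Γ →* (E ≃ₗᵢ[ℂ] E)), Nontrivial (ReducedH1 π) → HasFiniteDimSubrep π

/-- A discrete group is amenable if it has an invariant mean: a positive normalized linear
functional on the space `ℓ^∞(H)` of bounded real functions that is invariant under left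
translations. -/
def IsAmenableGroup (H : Type u) [Group H] : Prop :=
  ∃ m : lp (fun _ : H => ℝ) ∞ →ₗ[ℝ] ℝ,
    (∀ f : lp (fun _ : H => ℝ) ∞, (∀ x, 0 ≤ f x) → 0 ≤ m f) ∧
    m 1 = 1 ∧
    ∀ (h : H) (f f' : lp (fun _ : H => ℝ) ∞), (∀ x, f' x = f (h⁻¹ * x)) → m f' = m f

/-- The restricted wreath product `H ≀ G = (⨁_G H) ⋊ G`: the subgroup of the unrestricted regular
wreath product of the pairs `(f, x)` with `x : G` and `f : G → H` equal to `1` outside a finite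
set. -/
def restrictedWreathProduct (H : Type u) (G : Type v) [Group H] [Group G] : Subgroup (H ≀ᵣ G) where
  carrier := {a | (Function.mulSupport a.left).Finite}
  one_mem' := by simp
  mul_mem' := by
    intro a b ha hb
    refine (ha.union (hb.image fun x => a.right * x)).subset fun x hx => ?_
    by_contra hn
    simp only [Set.mem_union, not_or, Function.mem_mulSupport, not_not, Set.mem_image,
      not_exists, not_and] at hn
    refine hx ?_
    have h2 : b.left (a.right⁻¹ * x) = 1 := by
      by_contra h
      exact hn.2 _ h (by simp)
    simp [hn.1, h2]
  inv_mem' := by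
    intro a ha
    refine (ha.image fun x => a.right⁻¹ * x).subset fun x hx => ?_
    refine ⟨a.right * x, fun h => hx ?_, by simp⟩
    simp [h]

/-!
# Wreath products with infinite amenable lamps do not have property `H_FD`

Let `T` be a finite generating set of `H`. The map `v ↦ (v - π(s) v)_{s ∈ T}` attached to a
unitary representation `π` of `H` has the adjoint `b ↦ ∑ s, (b s - π(s)⁻¹ b s)`, called
`divergence` here; their composition is the Laplacian `Δ`. A cocycle of divergence zero is
*harmonic*. It is orthogonal to all coboundaries on `T`, so it is not a limit of coboundaries
unless it vanishes.

The group `H` has a nonzero harmonic cocycle (`IsAmenableGroup.exists_harmonic_cocycle`). Indeed,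
the regular representation has no invariant vectors because `H` is infinite, and it has almost
invariant vectors because `H` is amenable: a Hahn–Banach separation turns the invariant mean into
almost invariant probability vectors, whose square roots are almost invariant in `ℓ²`. Hence `Δ`
is injective and self-adjoint with dense range, and almost invariant vectors can be taken of the
form `Δ v`; by Cauchy–Schwarz the coboundaries of these `v`, scaled to energy `1`, have
arbitrarily small divergence (`exists_laplacian_small`). They converge to a harmonic cocycle of
energy `1` in the ultrapower of the regular representation (`exists_harmonic_cocycle`).

Given a representation `σ` of `H` on `V` with a harmonic cocycle `b ≠ 0`, let `H ≀ G` act on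
`ℓ²(G, V)`, where `G` translates and the copy of `H` at `x` acts by `σ` on the value at `x`.
Applying `b` to every lamp gives a cocycle. Restricted to the lamp at the identity of `G` it is
harmonic, so its class in reduced cohomology is nonzero (`nontrivial_reducedH1_wreathRep`). A
finite dimensional invariant subspace of `ℓ²(G, V)` is zero since `G` is infinite: translates of a
vector tend to zero pointwise, while the norm is preserved (`lp.eq_bot_of_translate_mem`).
-/

open Filter Topology UniformSpace

/-! ### Unitary representations from linear isometries -/

section LinearIsometries

variable {Γ : Type*} [Group Γ] {E : Type*} [NormedAddCommGroup E] [InnerProductSpace ℂ E]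

/-- A homomorphism from a group to the monoid of linear isometries of `E` takes its values in the
unitary group of `E`. -/
def unitaryRepOfIsometries (ρ : Γ →* (E →ₗᵢ[ℂ] E)) : Γ →* (E ≃ₗᵢ[ℂ] E) where
  toFun g :=
    { toFun := ρ g
      invFun := ρ g⁻¹
      map_add' := map_add _
      map_smul' := map_smul _
      left_inv := fun x => by
        change (ρ g⁻¹ * ρ g) x = x
        rw [← map_mul, inv_mul_cancel, map_one]; rfl
      right_inv := fun x => by
        change (ρ g * ρ g⁻¹) x = x
        rw [← map_mul, mul_inv_cancel, map_one]; rfl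
      norm_map' := (ρ g).norm_map }
  map_one' := by
    ext x
    change ρ 1 x = x
    rw [map_one]; rfl
  map_mul' g h := by
    ext x
    change ρ (g * h) x = ρ g (ρ h x)
    rw [map_mul]; rfl

lemma inner_map_inv (π : Γ →* (E ≃ₗᵢ[ℂ] E)) (g : Γ) (x y : E) :
    inner ℂ (π g⁻¹ x) y = inner ℂ x (π g y) := by
  rw [← (π g).inner_map_map (π g⁻¹ x) y]
  congr 1
  change (π g * π g⁻¹) x = x
  rw [← map_mul, mul_inv_cancel, map_one]; rfl

end LinearIsometries

/-! ### Divergence and Laplacian -/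

section Laplacian

variable {Γ : Type*} [Group Γ] {E : Type*} [NormedAddCommGroup E] [InnerProductSpace ℂ E]

/-- The divergence `∑_{s ∈ T} (b s - π(s)⁻¹ b s)` of `b : Γ → E` with respect to the finite set `T`.
It is the adjoint of the map that sends `v : E` to the family `(v - π(s) v)_{s ∈ T}`. -/
def divergence (π : Γ →* (E ≃ₗᵢ[ℂ] E)) (T : Finset Γ) (b : Γ → E) : E :=
  ∑ s ∈ T, (b s - π s⁻¹ (b s))

/-- The coboundary `g ↦ v - π(g) v` of the vector `v`. -/
def coboundaryMap (π : Γ →* (E ≃ₗᵢ[ℂ] E)) (v : E) (g : Γ) : E := v - π g v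

lemma inner_divergence (π : Γ →* (E ≃ₗᵢ[ℂ] E)) (T : Finset Γ) (b : Γ → E) (v : E) :
    inner ℂ (divergence π T b) v = ∑ s ∈ T, inner ℂ (b s) (coboundaryMap π v s) := by
  simp only [divergence, coboundaryMap, sum_inner, inner_sub_left, inner_sub_right, inner_map_inv]

lemma inner_divergence_coboundaryMap_self (π : Γ →* (E ≃ₗᵢ[ℂ] E)) (T : Finset Γ) (v : E) :
    inner ℂ (divergence π T (coboundaryMap π v)) v =
      ((∑ s ∈ T, ‖coboundaryMap π v s‖ ^ 2 : ℝ) : ℂ) := by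
  rw [inner_divergence]
  push_cast
  exact Finset.sum_congr rfl fun s _ => inner_self_eq_norm_sq_to_K _

/-- The Cauchy–Schwarz inequality for the form `⟨Δ v, w⟩`, where `Δ` is the Laplacian, applied
to `v` and `w = Δ v`. -/
lemma norm_laplacian_pow_four_le (π : Γ →* (E ≃ₗᵢ[ℂ] E)) (T : Finset Γ) (v : E) :
    ‖divergence π T (coboundaryMap π v)‖ ^ 4 ≤ (∑ s ∈ T, ‖coboundaryMap π v s‖ ^ 2) *
      ∑ s ∈ T, ‖coboundaryMap π (divergence π T (coboundaryMap π v)) s‖ ^ 2 := by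
  set w := divergence π T (coboundaryMap π v) with hw
  have h1 : ‖w‖ ^ 2 ≤ ∑ s ∈ T, ‖coboundaryMap π v s‖ * ‖coboundaryMap π w s‖ := by
    have h2 : ((‖w‖ ^ 2 : ℝ) : ℂ) =
        ∑ s ∈ T, inner ℂ (coboundaryMap π v s) (coboundaryMap π w s) := by
      rw [← inner_divergence, ← hw, inner_self_eq_norm_sq_to_K]; push_cast; rfl
    have h3 : ‖w‖ ^ 2 = ‖((‖w‖ ^ 2 : ℝ) : ℂ)‖ := by simp
    rw [h3, h2]
    exact (norm_sum_le _ _).trans (Finset.sum_le_sum fun s _ => norm_inner_le_norm _ _)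
  calc ‖w‖ ^ 4 = (‖w‖ ^ 2) ^ 2 := by ring
    _ ≤ (∑ s ∈ T, ‖coboundaryMap π v s‖ * ‖coboundaryMap π w s‖) ^ 2 := by gcongr
    _ ≤ _ := Finset.sum_mul_sq_le_sq_mul_sq _ _ _

lemma coboundaryMap_smul (π : Γ →* (E ≃ₗᵢ[ℂ] E)) (c : ℂ) (v : E) :
    coboundaryMap π (c • v) = c • coboundaryMap π v := by
  ext g
  simp [coboundaryMap, smul_sub]

lemma divergence_smul (π : Γ →* (E ≃ₗᵢ[ℂ] E)) (T : Finset Γ) (c : ℂ) (b : Γ → E) :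
    divergence π T (c • b) = c • divergence π T b := by
  simp [divergence, Finset.smul_sum, smul_sub]

/-- If `T` has almost invariant vectors but no invariant ones, then the Laplacian has almost
harmonic vectors of energy `1`. Since the Laplacian `Δ` is injective and self-adjoint, its range is
dense, so that almost invariant vectors can be chosen of the form `Δ v`. -/
theorem exists_laplacian_small [CompleteSpace E] (π : Γ →* (E ≃ₗᵢ[ℂ] E)) (T : Finset Γ)
    (hinv : ∀ v : E, (∀ s ∈ T, π s v = v) → v = 0)
    (hT : ∀ ε > 0, ∃ u : E, u ≠ 0 ∧ ∑ s ∈ T, ‖coboundaryMap π u s‖ ^ 2 < ε * ‖u‖ ^ 2)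
    {ε : ℝ} (hε : 0 < ε) :
    ∃ v : E, ∑ s ∈ T, ‖coboundaryMap π v s‖ ^ 2 = 1 ∧
      ‖divergence π T (coboundaryMap π v)‖ ^ 2 ≤ ε := by
  have hadd : ∀ v w, coboundaryMap π (v + w) = coboundaryMap π v + coboundaryMap π w := by
    intro v w
    ext g
    simp only [coboundaryMap, map_add, Pi.add_apply]
    abel
  have hdadd : ∀ b c, divergence π T (b + c) = divergence π T b + divergence π T c := by
    intro b c
    simp only [divergence, ← Finset.sum_add_distrib, Pi.add_apply, map_add]
    exact Finset.sum_congr rfl fun s _ => by abel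
  let A : E →ₗ[ℂ] E :=
    { toFun := fun v => divergence π T (coboundaryMap π v)
      map_add' := fun v w => by rw [hadd, hdadd]
      map_smul' := fun c v => by rw [coboundaryMap_smul, divergence_smul]; rfl }
  have hA : ∀ v, A v = divergence π T (coboundaryMap π v) := fun _ => rfl
  have hsymm : ∀ v w, inner ℂ (A v) w = inner ℂ v (A w) := by
    intro v w
    rw [← inner_conj_symm v, hA, hA, inner_divergence, inner_divergence, map_sum]
    exact Finset.sum_congr rfl fun s _ => (inner_conj_symm _ _).symm
  have hinj : ∀ v, A v = 0 → v = 0 := by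
    intro v hv
    refine hinv v fun s hs => ?_
    have h := inner_divergence_coboundaryMap_self π T v
    rw [← hA, hv, inner_zero_left] at h
    have h' : ∑ s ∈ T, ‖coboundaryMap π v s‖ ^ 2 = 0 := by exact_mod_cast h.symm
    have h0 := (Finset.sum_eq_zero_iff_of_nonneg fun s _ => by positivity).1 h' s hs
    have h1 : coboundaryMap π v s = 0 := by simpa using h0
    exact (sub_eq_zero.1 h1).symm
  -- A vector `w` orthogonal to the range of `A` satisfies `⟨A w, A w⟩ = ⟨A (A w), w⟩ = 0`.
  have hdense : Dense (Set.range A) := by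
    have : (LinearMap.range A).topologicalClosure = ⊤ := by
      rw [Submodule.topologicalClosure_eq_top_iff, Submodule.eq_bot_iff]
      intro w hw
      refine hinj w ?_
      have := (Submodule.mem_orthogonal _ _).1 hw (A (A w)) ⟨_, rfl⟩
      rw [hsymm] at this
      exact inner_self_eq_zero.1 this
    rw [← LinearMap.coe_range]
    exact (Submodule.dense_iff_topologicalClosure_eq_top).2 this
  have hopen : IsOpen {u : E | ∑ s ∈ T, ‖coboundaryMap π u s‖ ^ 2 < ε * ‖u‖ ^ 2} := by
    refine isOpen_lt ?_ (by fun_prop)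
    unfold coboundaryMap
    refine continuous_finsetSum _ fun s _ => ?_
    have h1 := (π s).continuous
    fun_prop
  obtain ⟨u₀, -, hu₀⟩ := hT ε hε
  obtain ⟨_, hu, v, rfl⟩ := hdense.inter_open_nonempty _ hopen ⟨u₀, hu₀⟩
  have hAv : A v ≠ 0 := by
    intro h
    simp [h, coboundaryMap] at hu
  have key := norm_laplacian_pow_four_le π T v
  rw [← hA] at key
  set N := ∑ s ∈ T, ‖coboundaryMap π v s‖ ^ 2 with hN
  have hN0 : 0 ≤ N := Finset.sum_nonneg fun s _ => by positivity
  have hAv' : 0 < ‖A v‖ := norm_pos_iff.2 hAv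
  have hle : ‖A v‖ ^ 2 ≤ N * ε := by
    have : ‖A v‖ ^ 2 * ‖A v‖ ^ 2 ≤ N * ε * ‖A v‖ ^ 2 := by
      calc _ = ‖A v‖ ^ 4 := by ring
        _ ≤ _ := key
        _ ≤ N * (ε * ‖A v‖ ^ 2) := by gcongr; exact hu.le
        _ = _ := by ring
    exact le_of_mul_le_mul_right this (by positivity)
  have hNpos : 0 < N := by
    have : 0 < N * ε := lt_of_lt_of_le (by positivity) hle
    exact pos_of_mul_pos_left this hε.le
  have hsq : ‖((Real.sqrt N)⁻¹ : ℂ)‖ ^ 2 = N⁻¹ := by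
    rw [norm_inv, inv_pow, Complex.norm_real, Real.norm_eq_abs, sq_abs, Real.sq_sqrt hN0]
  refine ⟨((Real.sqrt N)⁻¹ : ℂ) • v, ?_, ?_⟩
  · simp only [coboundaryMap_smul, Pi.smul_apply, norm_smul, mul_pow, hsq, ← Finset.mul_sum]
    exact inv_mul_cancel₀ hNpos.ne'
  · rw [coboundaryMap_smul, divergence_smul, norm_smul, mul_pow, hsq, ← hA]
    rw [inv_mul_le_iff₀ hNpos]
    exact hle

end Laplacian

/-! ### Ultraproducts of Hilbert spaces -/

section Ultraproduct

variable {E : Type u} [NormedAddCommGroup E]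

variable (E) in
/-- Bounded sequences in `E`, to be equipped with the semi-inner product
`⟪x, y⟫ = lim ⟪x n, y n⟫` along an ultrafilter; a type synonym that forgets the supremum norm. -/
def BoundedSeq : Type u := lp (fun _ : ℕ => E) ∞

namespace BoundedSeq

noncomputable instance : AddCommGroup (BoundedSeq E) :=
  inferInstanceAs (AddCommGroup (lp (fun _ : ℕ => E) ∞))

noncomputable instance [NormedSpace ℂ E] : Module ℂ (BoundedSeq E) :=
  inferInstanceAs (Module ℂ (lp (fun _ : ℕ => E) ∞))

/-- The terms of a bounded sequence. -/
def term (x : BoundedSeq E) (n : ℕ) : E := (show lp (fun _ : ℕ => E) ∞ from x) n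

lemma term_ext {x y : BoundedSeq E} (h : ∀ n, x.term n = y.term n) : x = y :=
  lp.ext (funext h)

@[simp] lemma term_add (x y : BoundedSeq E) (n : ℕ) : (x + y).term n = x.term n + y.term n := rfl

@[simp] lemma term_smul [NormedSpace ℂ E] (c : ℂ) (x : BoundedSeq E) (n : ℕ) :
    (c • x).term n = c • x.term n := rfl

/-- A bounded sequence from its terms. -/
def mk (x : ℕ → E) (hx : ∃ C, ∀ n, ‖x n‖ ≤ C) : BoundedSeq E :=
  (⟨x, memℓp_infty (by obtain ⟨C, hC⟩ := hx; exact ⟨C, by rintro _ ⟨n, rfl⟩; exact hC n⟩)⟩ :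
    lp (fun _ : ℕ => E) ∞)

@[simp] lemma term_mk (x : ℕ → E) (hx : ∃ C, ∀ n, ‖x n‖ ≤ C) (n : ℕ) : (mk x hx).term n = x n := rfl

lemma exists_norm_le (x : BoundedSeq E) : ∃ C, ∀ n, ‖x.term n‖ ≤ C :=
  ⟨_, lp.norm_apply_le_norm (p := ∞) (by simp) (show lp (fun _ : ℕ => E) ∞ from x)⟩

variable [InnerProductSpace ℂ E]

lemma exists_tendsto_inner (x y : BoundedSeq E) :
    ∃ c : ℂ, Tendsto (fun n => inner ℂ (x.term n) (y.term n)) (hyperfilter ℕ) (𝓝 c) := by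
  obtain ⟨C, hC⟩ := x.exists_norm_le
  obtain ⟨D, hD⟩ := y.exists_norm_le
  have hC0 : 0 ≤ C := (norm_nonneg _).trans (hC 0)
  obtain ⟨c, -, hc⟩ := (isCompact_closedBall (0 : ℂ) (C * D)).ultrafilter_le_nhds
    ((hyperfilter ℕ).map fun n => inner ℂ (x.term n) (y.term n)) (by
      rw [le_principal_iff]
      refine Filter.mem_map.2 (Filter.univ_mem' fun n => ?_)
      simp only [Set.mem_preimage, mem_closedBall_zero_iff]
      exact (norm_inner_le_norm _ _).trans (mul_le_mul (hC n) (hD n) (norm_nonneg _) hC0))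
  exact ⟨c, hc⟩

/-- The limit of the inner products of the terms along a nonprincipal ultrafilter. -/
noncomputable def limInner (x y : BoundedSeq E) : ℂ := (exists_tendsto_inner x y).choose

lemma tendsto_limInner (x y : BoundedSeq E) :
    Tendsto (fun n => inner ℂ (x.term n) (y.term n)) (hyperfilter ℕ) (𝓝 (limInner x y)) :=
  (exists_tendsto_inner x y).choose_spec

lemma limInner_eq {x y : BoundedSeq E} {c : ℂ}
    (h : Tendsto (fun n => inner ℂ (x.term n) (y.term n)) (hyperfilter ℕ) (𝓝 c)) :
    limInner x y = c :=
  tendsto_nhds_unique (tendsto_limInner x y) h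

/-- The semi-inner product of the ultraproduct. -/
noncomputable abbrev core : PreInnerProductSpace.Core ℂ (BoundedSeq E) where
  inner := limInner
  conj_inner_symm x y := by
    refine (limInner_eq ?_).symm
    refine ((Complex.continuous_conj.tendsto _).comp (tendsto_limInner y x)).congr fun n => ?_
    exact inner_conj_symm _ _
  re_inner_nonneg x := by
    refine ge_of_tendsto ((Complex.continuous_re.tendsto _).comp (tendsto_limInner x x)) ?_
    exact Eventually.of_forall fun n => inner_self_nonneg (𝕜 := ℂ)
  add_left x y z := by
    refine limInner_eq (((tendsto_limInner x z).add (tendsto_limInner y z)).congr fun n => ?_)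
    rw [term_add, inner_add_left]
  smul_left x y r := by
    refine limInner_eq (((tendsto_limInner x y).const_mul _).congr fun n => ?_)
    rw [term_smul, inner_smul_left]

noncomputable instance : SeminormedAddCommGroup (BoundedSeq E) :=
  InnerProductSpace.Core.toSeminormedAddCommGroup (𝕜 := ℂ) (c := core)

noncomputable instance : InnerProductSpace ℂ (BoundedSeq E) := InnerProductSpace.ofCore core

lemma inner_eq_limInner (x y : BoundedSeq E) : inner ℂ x y = limInner x y := rfl

lemma tendsto_norm_sq (x : BoundedSeq E) :
    Tendsto (fun n => ‖x.term n‖ ^ 2) (hyperfilter ℕ) (𝓝 (‖x‖ ^ 2)) := by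
  have h := (Complex.continuous_re.tendsto _).comp (tendsto_limInner x x)
  rw [← inner_eq_limInner] at h
  have h1 : (inner ℂ x x).re = ‖x‖ ^ 2 := (norm_sq_eq_re_inner (𝕜 := ℂ) x).symm
  rw [h1] at h
  exact h.congr fun n => (norm_sq_eq_re_inner (𝕜 := ℂ) _).symm

lemma norm_eq_of_term {x y : BoundedSeq E} (h : ∀ n, ‖x.term n‖ = ‖y.term n‖) : ‖x‖ = ‖y‖ := by
  have h1 := tendsto_nhds_unique (tendsto_norm_sq x)
    ((tendsto_norm_sq y).congr fun n => by rw [h n])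
  exact (sq_eq_sq₀ (norm_nonneg _) (norm_nonneg _)).1 h1

/-- The isometry of the ultraproduct that applies an isometry to each term. -/
noncomputable def map (U : E →ₗᵢ[ℂ] E) : BoundedSeq E →ₗᵢ[ℂ] BoundedSeq E where
  toFun x := mk (fun n => U (x.term n)) (by simpa using x.exists_norm_le)
  map_add' x y := term_ext fun n => by simp
  map_smul' c x := term_ext fun n => by simp
  norm_map' x := norm_eq_of_term fun n => by simp

@[simp] lemma term_map (U : E →ₗᵢ[ℂ] E) (x : BoundedSeq E) (n : ℕ) :
    (map U x).term n = U (x.term n) := rfl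

end BoundedSeq

variable [InnerProductSpace ℂ E]

/-- The extension of a linear isometry to the completion. -/
noncomputable def LinearIsometry.toCompletion {F : Type*} [SeminormedAddCommGroup F]
    [InnerProductSpace ℂ F] (U : F →ₗᵢ[ℂ] F) : Completion F →ₗᵢ[ℂ] Completion F where
  toFun := Completion.map U
  map_add' x y := by
    have hU := U.isometry.uniformContinuous
    refine Completion.induction_on₂ x y ?_ fun a b => ?_
    · have := Completion.continuous_map (f := U)
      exact isClosed_eq (by fun_prop) (by fun_prop)
    · rw [← Completion.coe_add, Completion.map_coe hU, Completion.map_coe hU,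
        Completion.map_coe hU, map_add, Completion.coe_add]
  map_smul' c x := by
    have hU := U.isometry.uniformContinuous
    refine Completion.induction_on x ?_ fun a => ?_
    · have := Completion.continuous_map (f := U)
      exact isClosed_eq (this.comp (continuous_const_smul c)) (this.const_smul c)
    · rw [← Completion.coe_smul, Completion.map_coe hU, Completion.map_coe hU, map_smul,
        Completion.coe_smul, RingHom.id_apply]
  norm_map' x := by
    have hU := U.isometry.uniformContinuous
    change ‖Completion.map U x‖ = ‖x‖
    refine Completion.induction_on x ?_ fun a => ?_
    · have := Completion.continuous_map (f := U)
      exact isClosed_eq (by fun_prop) (by fun_prop)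
    · rw [Completion.map_coe hU, Completion.norm_coe, Completion.norm_coe, U.norm_map]

lemma LinearIsometry.toCompletion_coe {F : Type*} [SeminormedAddCommGroup F]
    [InnerProductSpace ℂ F] (U : F →ₗᵢ[ℂ] F) (x : F) :
    U.toCompletion (x : Completion F) = (U x : F) :=
  Completion.map_coe U.isometry.uniformContinuous x

lemma LinearIsometry.toCompletion_ext {F : Type*} [SeminormedAddCommGroup F]
    [InnerProductSpace ℂ F] {U V : Completion F →ₗᵢ[ℂ] Completion F}
    (h : ∀ x : F, U x = V x) : U = V :=
  LinearIsometry.ext fun x => Completion.induction_on x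
    (isClosed_eq U.continuous V.continuous) h

/-- The ultrapower of a unitary representation, on the completed ultrapower of the Hilbert space. -/
noncomputable def ultrapowerRep {Γ : Type*} [Group Γ] (π : Γ →* (E ≃ₗᵢ[ℂ] E)) :
    Γ →* (Completion (BoundedSeq E) ≃ₗᵢ[ℂ] Completion (BoundedSeq E)) :=
  unitaryRepOfIsometries
    { toFun := fun g => (BoundedSeq.map (π g).toLinearIsometry).toCompletion
      map_one' := LinearIsometry.toCompletion_ext fun x => by
        rw [LinearIsometry.toCompletion_coe]
        refine congrArg _ (BoundedSeq.term_ext fun n => ?_)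
        simp
      map_mul' := fun g h => LinearIsometry.toCompletion_ext fun x => by
        change _ = LinearIsometry.toCompletion _ (LinearIsometry.toCompletion _ _)
        simp only [LinearIsometry.toCompletion_coe]
        refine congrArg _ (BoundedSeq.term_ext fun n => ?_)
        simp }

lemma ultrapowerRep_coe {Γ : Type*} [Group Γ] (π : Γ →* (E ≃ₗᵢ[ℂ] E)) (g : Γ)
    (x : BoundedSeq E) :
    ultrapowerRep π g (x : Completion (BoundedSeq E)) =
      (BoundedSeq.map (π g).toLinearIsometry x : BoundedSeq E) :=
  LinearIsometry.toCompletion_coe _ _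

end Ultraproduct

/-! ### Harmonic cocycles -/

section Harmonic

variable {Γ : Type*} [Group Γ] {E : Type u} [NormedAddCommGroup E] [InnerProductSpace ℂ E]

lemma coboundaryMap_mul (π : Γ →* (E ≃ₗᵢ[ℂ] E)) (v : E) (g h : Γ) :
    coboundaryMap π v (g * h) = coboundaryMap π v g + π g (coboundaryMap π v h) := by
  simp [coboundaryMap]

/-- A family of coboundaries that is bounded on a generating set is pointwise bounded. -/
lemma exists_norm_coboundaryMap_le (π : Γ →* (E ≃ₗᵢ[ℂ] E)) {T : Finset Γ}
    (hT : Subgroup.closure (T : Set Γ) = ⊤) {v : ℕ → E} {C : ℝ}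
    (hv : ∀ n, ∀ s ∈ T, ‖coboundaryMap π (v n) s‖ ≤ C) (g : Γ) :
    ∃ D, ∀ n, ‖coboundaryMap π (v n) g‖ ≤ D := by
  have hg : g ∈ Subgroup.closure (T : Set Γ) := hT ▸ Subgroup.mem_top g
  induction hg using Subgroup.closure_induction with
  | mem s hs => exact ⟨C, fun n => hv n s hs⟩
  | one => exact ⟨0, fun n => by simp [coboundaryMap]⟩
  | mul g h _ _ hg hh =>
    obtain ⟨D, hD⟩ := hg
    obtain ⟨D', hD'⟩ := hh
    refine ⟨D + D', fun n => ?_⟩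
    rw [coboundaryMap_mul]
    refine (norm_add_le _ _).trans (add_le_add (hD n) ?_)
    rw [LinearIsometryEquiv.norm_map]
    exact hD' n
  | inv g _ hg =>
    obtain ⟨D, hD⟩ := hg
    refine ⟨D, fun n => ?_⟩
    have h := coboundaryMap_mul π (v n) g g⁻¹
    have h1 : coboundaryMap π (v n) (g * g⁻¹) = 0 := by simp [coboundaryMap]
    rw [h1] at h
    rw [← (π g).norm_map, ← norm_neg, ← eq_neg_of_add_eq_zero_left h.symm]
    exact hD n

/-- Coboundaries of energy `1` that are asymptotically harmonic converge, in the ultrapower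
representation, to a harmonic cocycle of energy `1`. -/
theorem exists_harmonic_cocycle (π : Γ →* (E ≃ₗᵢ[ℂ] E)) {T : Finset Γ}
    (hT : Subgroup.closure (T : Set Γ) = ⊤) {v : ℕ → E}
    (hv : ∀ n, ∑ s ∈ T, ‖coboundaryMap π (v n) s‖ ^ 2 = 1)
    (hlim : Tendsto (fun n => ‖divergence π T (coboundaryMap π (v n))‖ ^ 2) atTop (𝓝 0)) :
    ∃ (V : Type u) (_ : NormedAddCommGroup V) (_ : InnerProductSpace ℂ V) (_ : CompleteSpace V)
      (σ : Γ →* (V ≃ₗᵢ[ℂ] V)) (b : Γ → V), b ∈ oneCocycles σ ∧ divergence σ T b = 0 ∧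
        ∑ s ∈ T, ‖b s‖ ^ 2 = 1 := by
  have hbound := exists_norm_coboundaryMap_le π (v := v) (C := 1) hT fun n s hs => by
    rw [← sq_le_one_iff₀ (norm_nonneg _), ← hv n]
    exact Finset.single_le_sum (f := fun s => ‖coboundaryMap π (v n) s‖ ^ 2)
      (fun _ _ => by positivity) hs
  let c : Γ → BoundedSeq E := fun g => BoundedSeq.mk (fun n => coboundaryMap π (v n) g) (hbound g)
  refine ⟨Completion (BoundedSeq E), inferInstance, inferInstance, inferInstance,
    ultrapowerRep π, fun g => (c g : Completion (BoundedSeq E)), ?_, ?_, ?_⟩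
  · intro g h
    simp only [ultrapowerRep_coe, ← Completion.coe_add]
    exact congrArg _ (BoundedSeq.term_ext fun n => coboundaryMap_mul π (v n) g h)
  · let d : BoundedSeq E := ∑ s ∈ T, (c s - BoundedSeq.map (π s⁻¹).toLinearIsometry (c s))
    have hd : divergence (ultrapowerRep π) T (fun g => (c g : Completion (BoundedSeq E))) = d := by
      simp only [divergence, ultrapowerRep_coe, ← Completion.coe_sub]
      exact (map_sum (Completion.toCompl (α := BoundedSeq E)) _ _).symm
    have hterm : ∀ n, d.term n = divergence π T (coboundaryMap π (v n)) := fun n => by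
      let ev : BoundedSeq E →+ E :=
        { toFun := fun x => x.term n, map_zero' := rfl, map_add' := fun _ _ => rfl }
      change ev d = _
      rw [map_sum]
      rfl
    rw [hd, ← norm_eq_zero, Completion.norm_coe]
    have h0 := tendsto_nhds_unique (BoundedSeq.tendsto_norm_sq d)
      ((hlim.mono_left Nat.hyperfilter_le_atTop).congr fun n => by rw [hterm])
    simpa using h0
  · simp only [Completion.norm_coe]
    refine tendsto_nhds_unique
      (tendsto_finsetSum T fun s _ => BoundedSeq.tendsto_norm_sq (c s)) ?_
    exact tendsto_const_nhds.congr fun n => (hv n).symm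

end Harmonic

/-! ### Translations of square summable functions -/

section Shift

/-- The isometry `ξ ↦ (i ↦ U i (ξ (e i)))` of `ℓ^p(ι, V)`, for a permutation `e` of `ι` and a family
`U` of isometries of `V`. -/
noncomputable def lp.twistedShift {𝕜 ι V : Type*} [RCLike 𝕜] [NormedAddCommGroup V]
    [NormedSpace 𝕜 V] {p : ℝ≥0∞} [hp : Fact (1 ≤ p)] (hp' : p ≠ ∞) (e : ι ≃ ι)
    (U : ι → V →ₗᵢ[𝕜] V) : lp (fun _ : ι => V) p →ₗᵢ[𝕜] lp (fun _ : ι => V) p where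
  toFun ξ := ⟨fun i => U i (ξ (e i)), by
    have h0 : 0 < p.toReal := ENNReal.toReal_pos (zero_lt_one.trans_le hp.out).ne' hp'
    refine memℓp_gen ?_
    simp only [LinearIsometry.norm_map]
    exact e.summable_iff.2 ((lp.memℓp ξ).summable h0)⟩
  map_add' ξ η := by
    ext i
    exact map_add (U i) _ _
  map_smul' c ξ := by
    ext i
    exact map_smul (U i) _ _
  norm_map' ξ := by
    have h0 : 0 < p.toReal := ENNReal.toReal_pos (zero_lt_one.trans_le hp.out).ne' hp'
    rw [lp.norm_eq_tsum_rpow h0, lp.norm_eq_tsum_rpow h0]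
    congr 1
    refine Eq.trans (tsum_congr fun i => ?_) (e.tsum_eq fun i => ‖ξ i‖ ^ p.toReal)
    exact congrArg (· ^ p.toReal) ((U i).norm_map _)

@[simp]
lemma lp.twistedShift_apply {𝕜 ι V : Type*} [RCLike 𝕜] [NormedAddCommGroup V]
    [NormedSpace 𝕜 V] {p : ℝ≥0∞} [hp : Fact (1 ≤ p)] (hp' : p ≠ ∞) (e : ι ≃ ι)
    (U : ι → V →ₗᵢ[𝕜] V) (ξ : lp (fun _ : ι => V) p) (i : ι) :
    lp.twistedShift hp' e U ξ i = U i (ξ (e i)) := rfl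

/-- Left translation by `g` on `ℓ^p(K, V)`. -/
noncomputable def lp.translate (𝕜 : Type*) {K V : Type*} [RCLike 𝕜] [NormedAddCommGroup V]
    [NormedSpace 𝕜 V] [Group K] {p : ℝ≥0∞} [Fact (1 ≤ p)] (hp' : p ≠ ∞) (g : K) :
    lp (fun _ : K => V) p →ₗᵢ[𝕜] lp (fun _ : K => V) p :=
  lp.twistedShift hp' (Equiv.mulLeft g⁻¹) fun _ => LinearIsometry.id

@[simp]
lemma lp.translate_apply {𝕜 K V : Type*} [RCLike 𝕜] [NormedAddCommGroup V]
    [NormedSpace 𝕜 V] [Group K] {p : ℝ≥0∞} [Fact (1 ≤ p)] (hp' : p ≠ ∞) (g : K)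
    (ξ : lp (fun _ : K => V) p) (x : K) : lp.translate 𝕜 hp' g ξ x = ξ (g⁻¹ * x) := rfl

lemma lp.hasSum_norm_sq {ι : Type*} {V : ι → Type*} [∀ i, NormedAddCommGroup (V i)] (ξ : lp V 2) :
    HasSum (fun i => ‖ξ i‖ ^ 2) (‖ξ‖ ^ 2) := by
  simpa using lp.hasSum_norm (p := 2) (by simp) ξ

lemma lp.hasSum_norm_one {ι : Type*} {V : ι → Type*} [∀ i, NormedAddCommGroup (V i)] (ξ : lp V 1) :
    HasSum (fun i => ‖ξ i‖) ‖ξ‖ := by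
  simpa using lp.hasSum_norm (p := 1) (by simp) ξ

lemma lp.tendsto_cofinite_zero {ι V : Type*} [NormedAddCommGroup V] (ξ : lp (fun _ : ι => V) 2) :
    Tendsto ξ cofinite (𝓝 0) := by
  have h := (lp.hasSum_norm_sq ξ).summable.tendsto_cofinite_zero
  rw [tendsto_zero_iff_norm_tendsto_zero]
  simpa using h.sqrt

/-- Over an infinite group, `ℓ²` has no nonzero finite dimensional subspace invariant under
translations: translates of a vector tend to zero pointwise, whereas in a finite dimensional
space they accumulate at a vector of the same norm. -/
theorem lp.eq_bot_of_translate_mem {K V : Type*} [Group K] [Infinite K] [NormedAddCommGroup V]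
    [InnerProductSpace ℂ V] (W : Submodule ℂ (lp (fun _ : K => V) 2)) [FiniteDimensional ℂ W]
    (hW : ∀ g : K, ∀ ξ ∈ W, lp.translate ℂ (by simp) g ξ ∈ W) : W = ⊥ := by
  rw [Submodule.eq_bot_iff]
  intro ξ hξ
  have : ProperSpace W := FiniteDimensional.proper ℂ W
  let orbit : K → W := fun g => ⟨lp.translate ℂ (by simp) g ξ, hW g ξ hξ⟩
  have hnorm : ∀ g, ‖orbit g‖ = ‖ξ‖ := fun g => (lp.translate ℂ (by simp) g).norm_map ξ
  obtain ⟨η, hη, hlim⟩ := (isCompact_sphere (0 : W) ‖ξ‖).ultrafilter_le_nhds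
    ((hyperfilter K).map orbit) (by
      rw [le_principal_iff]
      exact Filter.mem_map.2 (Filter.univ_mem' fun g => by simp [hnorm]))
  have hη0 : (η : lp (fun _ : K => V) 2) = 0 := by
    ext x
    have h1 : Tendsto (fun g => (orbit g : lp (fun _ : K => V) 2) x) (hyperfilter K)
        (𝓝 ((η : lp (fun _ : K => V) 2) x)) :=
      (((lp.evalCLM ℂ (fun _ : K => V) 2 x).continuous.comp continuous_subtype_val).tendsto
        η).comp hlim
    have h2 : Tendsto (fun g => (orbit g : lp (fun _ : K => V) 2) x) (hyperfilter K) (𝓝 0) := by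
      have hinj : Function.Injective fun g : K => g⁻¹ * x := fun a b h =>
        inv_injective (mul_right_cancel h)
      exact ((lp.tendsto_cofinite_zero ξ).comp hinj.tendsto_cofinite).mono_left
        hyperfilter_le_cofinite
    exact tendsto_nhds_unique h1 h2
  have : ‖ξ‖ = 0 := by
    rw [← mem_sphere_zero_iff_norm.1 hη]
    exact norm_eq_zero.2 (Subtype.ext hη0)
  exact norm_eq_zero.1 this

/-- The left regular representation on `ℓ²(K)`. -/
noncomputable def regularRep (K : Type*) [Group K] :
    K →* (lp (fun _ : K => ℂ) 2 ≃ₗᵢ[ℂ] lp (fun _ : K => ℂ) 2) :=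
  unitaryRepOfIsometries
    { toFun := lp.translate ℂ (by simp)
      map_one' := by
        ext ξ x
        simp
      map_mul' := fun g h => by
        ext ξ x
        simp [mul_assoc] }

lemma regularRep_eq_zero_of_invariant {K : Type*} [Group K] [Infinite K] {T : Set K}
    (hT : Subgroup.closure T = ⊤) {ξ : lp (fun _ : K => ℂ) 2}
    (h : ∀ s ∈ T, regularRep K s ξ = ξ) : ξ = 0 := by
  have hall : ∀ g : K, regularRep K g ξ = ξ := by
    intro g
    have hg : g ∈ Subgroup.closure T := hT ▸ Subgroup.mem_top g
    induction hg using Subgroup.closure_induction with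
    | mem s hs => exact h s hs
    | one => simp
    | mul a b _ _ ha hb =>
      rw [map_mul]
      change regularRep K a (regularRep K b ξ) = ξ
      rw [hb, ha]
    | inv a _ ha =>
      conv_lhs => rw [← ha]
      change (regularRep K a⁻¹ * regularRep K a) ξ = ξ
      rw [← map_mul, inv_mul_cancel, map_one]
      rfl
  -- An invariant vector spans an invariant subspace of dimension at most one.
  have hbot := lp.eq_bot_of_translate_mem (ℂ ∙ ξ) fun g η hη => by
    obtain ⟨c, rfl⟩ := Submodule.mem_span_singleton.1 hη
    rw [map_smul]
    refine Submodule.smul_mem _ _ (Submodule.mem_span_singleton.2 ⟨1, ?_⟩)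
    rw [one_smul]
    exact (hall g).symm
  exact Submodule.span_singleton_eq_bot.1 hbot

end Shift

/-! ### Almost invariant vectors from amenability -/

section Amenable

variable {H : Type u} [Group H]

/-- Reiter's condition in `ℓ¹`. If it failed, a functional separating the differences
`(f - s f)_{s ∈ T}` of probability vectors `f` from a neighbourhood of zero would give bounded
functions `φ s` such that `∑ s, (φ s x - φ s (s x))` is bounded below by a positive constant,
although an invariant mean vanishes on this function. -/
theorem IsAmenableGroup.exists_almost_invariant_one (hH : IsAmenableGroup H) (T : Finset H)
    {ε : ℝ} (hε : 0 < ε) :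
    ∃ f : lp (fun _ : H => ℝ) 1, (∀ x, 0 ≤ f x) ∧ ∑' x, f x = 1 ∧
      ∀ s ∈ T, ‖f - lp.translate ℝ (by simp) s f‖ < ε := by
  classical
  let τ (s : H) : lp (fun _ : H => ℝ) 1 →ₗᵢ[ℝ] lp (fun _ : H => ℝ) 1 := lp.translate ℝ (by simp) s
  let D : lp (fun _ : H => ℝ) 1 →ₗ[ℝ] (T → lp (fun _ : H => ℝ) 1) :=
    LinearMap.pi fun s => LinearMap.id - (τ s).toLinearMap
  have hD : ∀ f s, D f s = f - τ s f := fun _ _ => rfl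
  let P : Set (lp (fun _ : H => ℝ) 1) :=
    {f | (∀ x, 0 ≤ f x) ∧ lp.tsumCLM (α := H) (𝕜 := ℝ) (E := ℝ) f = 1}
  have hP : Convex ℝ P := by
    rintro f ⟨hf, hf1⟩ g ⟨hg, hg1⟩ a b ha hb hab
    refine ⟨fun x => ?_, ?_⟩
    · exact add_nonneg (mul_nonneg ha (hf x)) (mul_nonneg hb (hg x))
    · rw [map_add, map_smul, map_smul, hf1, hg1]
      simpa using hab
  by_contra! hcon
  have hdisj : Disjoint (Metric.ball (0 : T → lp (fun _ : H => ℝ) 1) ε) (D '' P) := by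
    rw [Set.disjoint_left]
    rintro _ hball ⟨f, ⟨hf, hf1⟩, rfl⟩
    obtain ⟨s, hs, hsε⟩ := hcon f hf hf1
    rw [mem_ball_zero_iff] at hball
    exact absurd ((norm_le_pi_norm (D f) ⟨s, hs⟩).trans_lt hball) (not_lt.2 hsε)
  obtain ⟨Φ, c, hΦ, hc⟩ := geometric_hahn_banach_open (convex_ball _ _) Metric.isOpen_ball
    (hP.linear_image D) hdisj
  have hc0 : 0 < c := by simpa using hΦ 0 (Metric.mem_ball_self hε)
  let δ (x : H) : lp (fun _ : H => ℝ) 1 := lp.single 1 x 1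
  have hδ : ∀ x, δ x ∈ P := by
    intro x
    refine ⟨fun y => ?_, ?_⟩
    · simp only [δ, lp.coeFn_single]
      rcases eq_or_ne y x with rfl | h
      · simp
      · simp [h]
    · simp only [lp.tsumCLM_apply, δ, lp.coeFn_single]
      exact (tsum_eq_single x fun y hy => by simp [hy]).trans (by simp)
  have hτδ : ∀ s x, τ s (δ x) = δ (s * x) := by
    intro s x
    ext y
    simp only [τ, δ, lp.translate_apply, lp.coeFn_single, Pi.single_apply, inv_mul_eq_iff_eq_mul]
  have hbdd : ∀ s x, ‖Φ (Pi.single s (δ x))‖ ≤ ‖Φ‖ := by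
    intro s x
    refine (Φ.le_opNorm _).trans (mul_le_of_le_one_right (norm_nonneg _) ?_)
    rw [Pi.norm_single, lp.norm_single (by simp)]
    simp
  -- The components of `Φ` as bounded functions on `H`, and their translates.
  let φ (s : T) : lp (fun _ : H => ℝ) ∞ := ⟨fun x => Φ (Pi.single s (δ x)),
    memℓp_infty ⟨‖Φ‖, by rintro _ ⟨x, rfl⟩; exact hbdd s x⟩⟩
  let ψ (s : T) : lp (fun _ : H => ℝ) ∞ := ⟨fun x => Φ (Pi.single s (δ (s * x))),
    memℓp_infty ⟨‖Φ‖, by rintro _ ⟨x, rfl⟩; exact hbdd s _⟩⟩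
  have hlow : ∀ x, c ≤ ∑ s : T, (φ s x - ψ s x) := by
    intro x
    have h := hc _ ⟨δ x, hδ x, rfl⟩
    have hsum : D (δ x) = ∑ s : T, (Pi.single s (δ x) - Pi.single s (δ (s * x))) := by
      simp only [← Pi.single_sub]
      rw [Finset.univ_sum_single (fun s : T => δ x - δ (s * x))]
      ext1 s
      rw [hD, hτδ]
    rw [hsum, map_sum] at h
    simpa only [map_sub] using h
  obtain ⟨m, hpos, hone, hmean⟩ := hH
  have h0 := hpos (∑ s : T, (φ s - ψ s) - c • 1) fun x => by
    rw [lp.coeFn_sub, Pi.sub_apply, lp.coeFn_sum, Finset.sum_apply]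
    simpa using hlow x
  have hzero : ∀ s : T, m (ψ s) = m (φ s) := fun s =>
    hmean (s : H)⁻¹ (φ s) (ψ s) fun x => by
      rw [inv_inv]
  rw [map_sub, map_sum, map_smul, hone] at h0
  simp only [map_sub, hzero, sub_self, Finset.sum_const_zero] at h0
  simp at h0
  linarith

lemma sq_sqrt_sub_sqrt_le {a b : ℝ} (ha : 0 ≤ a) (hb : 0 ≤ b) :
    (Real.sqrt a - Real.sqrt b) ^ 2 ≤ |a - b| := by
  have h1 : a - b = (Real.sqrt a - Real.sqrt b) * (Real.sqrt a + Real.sqrt b) := by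
    ring_nf
    rw [Real.sq_sqrt ha, Real.sq_sqrt hb]
  rw [h1, abs_mul, ← sq_abs, sq]
  refine mul_le_mul_of_nonneg_left ?_ (abs_nonneg _)
  rw [abs_of_nonneg (a := _ + _) (by positivity)]
  refine abs_le.2 ⟨?_, ?_⟩ <;> linarith [Real.sqrt_nonneg a, Real.sqrt_nonneg b]

/-- The regular representation of an amenable group has almost invariant vectors, namely the square
roots of almost invariant probability vectors. -/
theorem IsAmenableGroup.exists_almost_invariant (hH : IsAmenableGroup H) (T : Finset H)
    {ε : ℝ} (hε : 0 < ε) :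
    ∃ ξ : lp (fun _ : H => ℂ) 2, ξ ≠ 0 ∧
      ∑ s ∈ T, ‖coboundaryMap (regularRep H) ξ s‖ ^ 2 < ε * ‖ξ‖ ^ 2 := by
  obtain ⟨f, hf, hf1, hfT⟩ := hH.exists_almost_invariant_one T (ε := ε / (T.card + 1))
    (by positivity)
  have hsum : HasSum f 1 := by
    rw [← hf1]
    refine Summable.hasSum (Summable.of_norm (lp.hasSum_norm_one f).summable)
  have hsq : ∀ x, ‖((Real.sqrt (f x) : ℝ) : ℂ)‖ ^ 2 = f x := fun x => by
    rw [Complex.norm_real, Real.norm_eq_abs, sq_abs, Real.sq_sqrt (hf x)]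
  let ξ : lp (fun _ : H => ℂ) 2 := ⟨fun x => ((Real.sqrt (f x) : ℝ) : ℂ), by
    refine memℓp_gen ?_
    simpa [hsq, Real.sq_sqrt (hf _)] using hsum.summable⟩
  have hξ : ‖ξ‖ ^ 2 = 1 := by
    refine (lp.hasSum_norm_sq ξ).unique ?_
    simpa only [ξ, hsq] using hsum
  refine ⟨ξ, ?_, ?_⟩
  · intro h
    simp [h] at hξ
  · have hs : ∀ s ∈ T, ‖coboundaryMap (regularRep H) ξ s‖ ^ 2 ≤ ε / (T.card + 1) := by
      intro s hs
      refine le_trans ?_ (hfT s hs).le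
      refine hasSum_le (fun x => ?_) (lp.hasSum_norm_sq (coboundaryMap (regularRep H) ξ s))
        (lp.hasSum_norm_one _)
      change ‖((Real.sqrt (f x) : ℝ) : ℂ) - ((Real.sqrt (f (s⁻¹ * x)) : ℝ) : ℂ)‖ ^ 2 ≤
        |f x - f (s⁻¹ * x)|
      rw [← Complex.ofReal_sub, Complex.norm_real, Real.norm_eq_abs, sq_abs]
      exact sq_sqrt_sub_sqrt_le (hf _) (hf _)
    calc _ ≤ T.card • (ε / (T.card + 1)) := Finset.sum_le_card_nsmul _ _ _ hs
      _ < ε * ‖ξ‖ ^ 2 := by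
        rw [hξ, nsmul_eq_mul, mul_one, mul_div_assoc', div_lt_iff₀ (by positivity)]
        nlinarith

/-- A finitely generated infinite amenable group has a harmonic cocycle of energy `1`. -/
theorem IsAmenableGroup.exists_harmonic_cocycle [Infinite H] (hH : IsAmenableGroup H)
    {T : Finset H} (hT : Subgroup.closure (T : Set H) = ⊤) :
    ∃ (V : Type u) (_ : NormedAddCommGroup V) (_ : InnerProductSpace ℂ V) (_ : CompleteSpace V)
      (σ : H →* (V ≃ₗᵢ[ℂ] V)) (b : H → V), b ∈ oneCocycles σ ∧ divergence σ T b = 0 ∧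
        ∑ s ∈ T, ‖b s‖ ^ 2 = 1 := by
  have h (n : ℕ) := exists_laplacian_small (regularRep H) T
    (fun ξ hξ => regularRep_eq_zero_of_invariant hT hξ)
    (fun ε hε => hH.exists_almost_invariant T hε) (Nat.one_div_pos_of_nat (α := ℝ) (n := n))
  choose v hv hv' using h
  exact _root_.exists_harmonic_cocycle (regularRep H) hT hv
    (squeeze_zero (fun n => by positivity) hv' tendsto_one_div_add_atTop_nhds_zero_nat)

end Amenable

/-! ### The representation of the wreath product -/

section Wreath

variable {H : Type*} {G : Type*} [Group H] [Group G] {V : Type*} [NormedAddCommGroup V]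
  [InnerProductSpace ℂ V]

/-- The representation of `H ≀ G` on `ℓ²(G, V)` attached to the representation `σ` of `H` on `V`:
`G` acts by translations and the copy of `H` at `x` acts by `σ` on the value at `x`. -/
noncomputable def wreathRep (G : Type*) [Group G] (σ : H →* (V ≃ₗᵢ[ℂ] V)) :
    restrictedWreathProduct H G →* (lp (fun _ : G => V) 2 ≃ₗᵢ[ℂ] lp (fun _ : G => V) 2) :=
  unitaryRepOfIsometries
    { toFun := fun a => lp.twistedShift (by simp) (Equiv.mulLeft a.1.right⁻¹)
        fun x => (σ (a.1.left x)).toLinearIsometry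
      map_one' := by
        ext ξ x
        simp
      map_mul' := fun a b => by
        ext ξ x
        simp }

@[simp]
lemma wreathRep_apply (σ : H →* (V ≃ₗᵢ[ℂ] V)) (a : restrictedWreathProduct H G)
    (ξ : lp (fun _ : G => V) 2) (x : G) :
    wreathRep G σ a ξ x = σ (a.1.left x) (ξ (a.1.right⁻¹ * x)) := rfl

/-- The copy of `G` in `H ≀ G`. -/
def restrictedWreathProduct.base (x : G) : restrictedWreathProduct H G :=
  ⟨⟨1, x⟩, by simp [restrictedWreathProduct]⟩

open Classical in
/-- The copy of `H` in `H ≀ G` at the identity of `G`. -/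
noncomputable def restrictedWreathProduct.lamp (h : H) : restrictedWreathProduct H G :=
  ⟨⟨Pi.mulSingle 1 h, 1⟩, (Set.finite_singleton 1).subset Pi.mulSupport_mulSingle_subset⟩

open restrictedWreathProduct

lemma not_hasFiniteDimSubrep_wreathRep [Infinite G] (σ : H →* (V ≃ₗᵢ[ℂ] V)) :
    ¬ HasFiniteDimSubrep (wreathRep G σ) := by
  rintro ⟨W, hW, hfin, hinv⟩
  refine hW (lp.eq_bot_of_translate_mem W fun g ξ hξ => ?_)
  have heq : lp.translate ℂ (by simp) g ξ = wreathRep G σ (base g) ξ := by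
    ext x
    simp [base]
  exact heq ▸ hinv _ ξ hξ

variable {σ : H →* (V ≃ₗᵢ[ℂ] V)} {b : H → V}

lemma oneCocycles_apply_one (hb : b ∈ oneCocycles σ) : b 1 = 0 := by
  simpa using hb 1 1

/-- The cocycle of `H ≀ G` that applies a cocycle `b` of `H` to every lamp. -/
noncomputable def wreathCocycle (G : Type*) [Group G] (hb : b ∈ oneCocycles σ) :
    oneCocycles (wreathRep G σ) :=
  ⟨fun a => ⟨fun x => b (a.1.left x), by
      refine (memℓp_zero (a.2.subset fun x hx h => hx ?_)).of_exponent_ge (by simp)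
      rw [h, oneCocycles_apply_one hb]⟩, fun a c => by
    ext x
    exact hb _ _⟩

lemma wreathCocycle_lamp (hb : b ∈ oneCocycles σ) (h : H) [DecidableEq G] :
    (wreathCocycle G hb).1 (lamp h) = lp.single (E := fun _ : G => V) 2 1 (b h) := by
  ext x
  change b _ = _
  rw [lp.coeFn_single]
  rcases eq_or_ne x 1 with rfl | hx
  · simp [lamp]
  · simp [lamp, hx, oneCocycles_apply_one hb]

/-- Pairing with a cocycle that is harmonic on the lamps is a continuous functional on the space of
cocycles which vanishes on coboundaries but not on the cocycle itself. -/
theorem nontrivial_reducedH1_wreathRep (hb : b ∈ oneCocycles σ) {T : Finset H}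
    (hdiv : divergence σ T b = 0) (hone : ∑ s ∈ T, ‖b s‖ ^ 2 = 1) :
    Nontrivial (ReducedH1 (wreathRep G σ)) := by
  classical
  let Φ : oneCocycles (wreathRep G σ) → ℂ := fun c =>
    ∑ s ∈ T, inner ℂ (lp.single 2 1 (b s) : lp (fun _ : G => V) 2) (c.1 (lamp s))
  have hcont : Continuous Φ := by
    refine continuous_finsetSum _ fun s _ => ?_
    exact continuous_const.inner ((continuous_apply _).comp continuous_subtype_val)
  have hcob : ∀ c ∈ oneCoboundaries (wreathRep G σ), Φ c = 0 := by
    rintro c ⟨ξ, hξ⟩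
    have hΦ : Φ c = ∑ s ∈ T, inner ℂ (b s) (coboundaryMap σ (ξ 1) s) := by
      refine Finset.sum_congr rfl fun s _ => ?_
      rw [hξ, lp.inner_single_left]
      simp [coboundaryMap, lamp, inner_sub_right]
    rw [hΦ, ← inner_divergence, hdiv, inner_zero_left]
  have hclos : ∀ c ∈ (oneCoboundaries (wreathRep G σ)).topologicalClosure, Φ c = 0 := fun c hc =>
    closure_minimal (t := {c | Φ c = 0}) hcob (isClosed_eq hcont continuous_const) hc
  -- It suffices that `wreathCocycle G hb` is not in the closure of the coboundaries.
  rw [Submodule.Quotient.nontrivial_iff]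
  intro htop
  have h0 := hclos (wreathCocycle G hb) (htop ▸ Submodule.mem_top)
  have h1 : Φ (wreathCocycle G hb) = ((∑ s ∈ T, ‖b s‖ ^ 2 : ℝ) : ℂ) := by
    push_cast
    refine Finset.sum_congr rfl fun s _ => ?_
    rw [wreathCocycle_lamp, lp.inner_single_left, lp.single_apply_self]
    exact inner_self_eq_norm_sq_to_K _
  rw [h1, hone] at h0
  simp at h0

end Wreath

/-! ### Failure of property `H_FD` -/

theorem propositionA1 {H : Type u} {G : Type v} [Group H] [Group G]
    [Group.FG H] [Group.FG G] [Infinite H] [Infinite G] (hH : IsAmenableGroup H) :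
    ¬ PropertyHFD (restrictedWreathProduct H G) := by
  intro hFD
  obtain ⟨T, hT⟩ := Group.fg_def.1 (inferInstance : Group.FG H)
  obtain ⟨V, _, _, _, σ, b, hb, hdiv, hone⟩ := hH.exists_harmonic_cocycle hT
  exact not_hasFiniteDimSubrep_wreathRep σ
    (hFD _ (wreathRep G σ) (nontrivial_reducedH1_wreathRep hb hdiv hone))
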